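/- Write $[x,y]=x^{-1}y^{-1}xy$, and write $G'$ and $Z(G)$ for the commutator subgroup and the center of a group $G$. Let $\mathcal N_2$ be the variety of groups that are nilpotent of class at most two (that is, $G'\subseteq Z(G)$), and for $m>0$ let $\mathcal B_m$ be the variety of groups satisfying the identity $x^m=e$. Let $G^m$ be the subgroup of $G$ generated by all $m$-th powers of elements of $G$. Let $\mathcal C$ be a class of groups. An amalgam $(K_1,K_2;G)$ of $\mathcal C$-groups with core $G$ consists of groups $G,K_1,K_2\in\mathcal C$ and injective morphisms $\varphi_1\colon G\to K_1$, $\varphi_2\colon G\to K_2$. It is weakly embeddable in $\mathcal C$ if there are a group $M\in\mathcal C$ and injective morphisms $\lambda_1\colon K_1\to M$, $\lambda_2\colon K_2\to M$ with $\lambda_1\circ\varphi_1=\lambda_2\circ\varphi_2$. It is strongly embeddable in $\mathcal C$ if these can be chosen so that, in addition, $\lambda_1(a)=\lambda_2(b)$ (with $a\in K_1$, $b\in K_2$) only when $a\in\varphi_1(G)$ and $b\in\varphi_2(G)$. A group $G\in\mathcal C$ is a weak (respectively strong) amalgamation base for $\mathcal C$ if every amalgam of $\mathcal C$-groups with core $G$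 is weakly (respectively strongly) embeddable in $\mathcal C$. Theorem. Let $p$ be an odd prime, let $n>0$, and let $G\in\mathcal N_2\cap\mathcal B_{p^n}$. The following are equivalent: (i) $G$ is a weak amalgamation base for $\mathcal N_2$. (ii) $G$ is a weak amalgamation base for $\mathcal N_2\cap\mathcal B_{p^n}$. (iii) $Z(G)=G'$, and for each $i$ with $1\le i\le n-1$ and each $g\in G$, either $g\in G^{p^i}G'$, or there exist an integer $c>0$ and $y\in G$ with $y^{p^i}\equiv g^c\pmod{G'}$ and $[y,g]\ne e$. (iv) $G$ is a strong amalgamation base for $\mathcal N_2\cap\mathcal B_{p^n}$. (v) $G$ is a strong amalgamation base for $\mathcal N_2$. -/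

import Mathlib

universe u

namespace NilTwo

/-- A class of groups (e.g. a variety), given as a predicate on groups. -/
abbrev GroupClass : Type (u + 1) := ∀ (H : Type u) [Group H], Prop

/-- The variety `N₂` of nilpotent groups of class at most two: `[H, H] ⊆ Z(H)`. -/
def N₂ : GroupClass.{u} := fun H _ => commutator H ≤ Subgroup.center H

/-- The variety `B_m` of groups of exponent `m`, i.e. groups satisfying the identity `x ^ m = e`. -/
def B (m : ℕ) : GroupClass.{u} := fun H _ => ∀ x : H, x ^ m = 1

/-- The variety `N₂ ∩ B_m`. -/
def N₂B (m : ℕ) : GroupClass.{u} := fun H _ => N₂ H ∧ B m H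

/-- The amalgam `(K₁, K₂; G)` with structure maps `φ₁`, `φ₂` is weakly embeddable in `C`:
there is a group `M` in `C` and injective morphisms `K₁ → M`, `K₂ → M` that agree on `G`. -/
def WeaklyEmbeddable (C : GroupClass.{u}) {G K₁ K₂ : Type u} [Group G] [Group K₁] [Group K₂]
    (φ₁ : G →* K₁) (φ₂ : G →* K₂) : Prop :=
  ∃ (M : Type u) (_ : Group M) (l₁ : K₁ →* M) (l₂ : K₂ →* M),
    C M ∧ Function.Injective l₁ ∧ Function.Injective l₂ ∧ l₁.comp φ₁ = l₂.comp φ₂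

/-- The amalgam `(K₁, K₂; G)` is strongly embeddable in `C`: there is a weak embedding in which,
moreover, an element of `K₁` is identified with an element of `K₂` only if both come from `G`. -/
def StronglyEmbeddable (C : GroupClass.{u}) {G K₁ K₂ : Type u} [Group G] [Group K₁] [Group K₂]
    (φ₁ : G →* K₁) (φ₂ : G →* K₂) : Prop :=
  ∃ (M : Type u) (_ : Group M) (l₁ : K₁ →* M) (l₂ : K₂ →* M),
    C M ∧ Function.Injective l₁ ∧ Function.Injective l₂ ∧ l₁.comp φ₁ = l₂.comp φ₂ ∧
      ∀ (a : K₁) (b : K₂), l₁ a = l₂ b → a ∈ φ₁.range ∧ b ∈ φ₂.range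

/-- `G` belongs to `C`, and every amalgam of `C`-groups with core `G` is weakly embeddable in `C`. -/
def IsWeakAmalgamationBase (C : GroupClass.{u}) (G : Type u) [Group G] : Prop :=
  C G ∧ ∀ (K₁ K₂ : Type u) [Group K₁] [Group K₂] (φ₁ : G →* K₁) (φ₂ : G →* K₂),
    C K₁ → C K₂ → Function.Injective φ₁ → Function.Injective φ₂ → WeaklyEmbeddable C φ₁ φ₂

/-- `G` belongs to `C`, and every amalgam of `C`-groups with core `G` is strongly embeddable
in `C`. -/
def IsStrongAmalgamationBase (C : GroupClass.{u}) (G : Type u) [Group G] : Prop :=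
  C G ∧ ∀ (K₁ K₂ : Type u) [Group K₁] [Group K₂] (φ₁ : G →* K₁) (φ₂ : G →* K₂),
    C K₁ → C K₂ → Function.Injective φ₁ → Function.Injective φ₂ → StronglyEmbeddable C φ₁ φ₂

/-- The subgroup `G ^ m`, generated by all `m`-th powers. -/
def powSubgroup (m : ℕ) (G : Type u) [Group G] : Subgroup G :=
  Subgroup.closure (Set.range fun x : G => x ^ m)

end NilTwo

-- Condition (iii) controls roots in overgroups. In class two a commutator depends only on classes
-- modulo the commutator subgroup. So if K contains G and x in K satisfies x^q ≡ g mod K', with q =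
-- p^i, then [y,g] = [y^q,x] for every y, and this is trivial when y^q ≡ g^c. The elements y in
-- (iii) therefore prevent g from becoming a q-th power in K/K' unless it already is one in G/G';
-- with Z(G) = G' this makes G/G' a pure subgroup of K/K' (`pure_of_rootObstructed`).
--
-- Being pure and of bounded exponent, G/G' is a direct summand (`exists_add_retraction`), so K
-- retracts onto G/G'. Given retractions of K₁ and K₂, mixed commutators can be prescribed as [x,y]
-- = [x,h][g,y][g,h]⁻¹, where g and h lift the retractions of x and y. Deforming the product on K₁ ×
-- K₂ accordingly and dividing by the elements (g, g⁻¹) yields a strong amalgam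
-- (`stronglyEmbeddable_of_retractions`).
--
-- Conversely, a failure of (iii) at g gives two incompatible overgroups of exponent p^n. In one, g
-- fails to commute with some y such that y^q = 1; in the other, g = a r^q with a a commutator. A
-- common overgroup would give [y,g] = [y^q,r] = 1. If g is central but not in G', it can itself be
-- made a commutator. Since p is odd, torsion subgroups transfer embeddings from N₂ to exponent p^n.

universe v

open scoped commutatorElement

namespace NilTwo

/-! ### Commutator calculus and torsion in class two. -/

section Basic

variable {M : Type u} [Group M]

theorem N₂_iff : N₂ M ↔ ∀ x y z : M, ⁅x, y⁆ * z = z * ⁅x, y⁆ := by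
  unfold N₂
  rw [commutator_def, Subgroup.commutator_le]
  simp only [Subgroup.mem_top, true_implies, Subgroup.mem_center_iff]
  exact ⟨fun h x y z => (h x y z).symm, fun h x y z => (h x y z).symm⟩

theorem N₂.comm (h : N₂ M) (x y z : M) : ⁅x, y⁆ * z = z * ⁅x, y⁆ :=
  N₂_iff.1 h x y z

theorem N₂.mul_left (h : N₂ M) (x y z : M) : ⁅x * y, z⁆ = ⁅x, z⁆ * ⁅y, z⁆ := by
  have : ⁅x * y, z⁆ = x * ⁅y, z⁆ * x⁻¹ * ⁅x, z⁆ := by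
    simp only [commutatorElement_def]; group
  rw [this, ← h.comm y z x, mul_inv_cancel_right, h.comm]

theorem N₂.mul_right (h : N₂ M) (x y z : M) : ⁅x, y * z⁆ = ⁅x, y⁆ * ⁅x, z⁆ := by
  rw [← commutatorElement_inv, h.mul_left, mul_inv_rev, commutatorElement_inv,
    commutatorElement_inv, h.comm]

/-- In a group of class at most two, `x ↦ ⁅x, y⁆` is a homomorphism. -/
def N₂.commLeft (h : N₂ M) (y : M) : M →* M :=
  MonoidHom.mk' (fun x => ⁅x, y⁆) fun a b => h.mul_left a b y

/-- In a group of class at most two, `y ↦ ⁅x, y⁆` is a homomorphism. -/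
def N₂.commRight (h : N₂ M) (x : M) : M →* M :=
  MonoidHom.mk' (fun y => ⁅x, y⁆) fun a b => h.mul_right x a b

theorem N₂.pow_left (h : N₂ M) (x y : M) (m : ℕ) : ⁅x ^ m, y⁆ = ⁅x, y⁆ ^ m :=
  map_pow (h.commLeft y) x m

theorem N₂.pow_right (h : N₂ M) (x y : M) (m : ℕ) : ⁅x, y ^ m⁆ = ⁅x, y⁆ ^ m :=
  map_pow (h.commRight x) y m

theorem N₂.zpow_left (h : N₂ M) (x y : M) (m : ℤ) : ⁅x ^ m, y⁆ = ⁅x, y⁆ ^ m :=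
  map_zpow (h.commLeft y) x m

theorem N₂.zpow_right (h : N₂ M) (x y : M) (m : ℤ) : ⁅x, y ^ m⁆ = ⁅x, y⁆ ^ m :=
  map_zpow (h.commRight x) y m

theorem N₂.inv_left (h : N₂ M) (x y : M) : ⁅x⁻¹, y⁆ = ⁅x, y⁆⁻¹ :=
  map_inv (h.commLeft y) x

theorem N₂.inv_right (h : N₂ M) (x y : M) : ⁅x, y⁻¹⁆ = ⁅x, y⁆⁻¹ :=
  map_inv (h.commRight x) y

theorem N₂.of_ker_central (h : N₂ M) {x : M} (hx : Abelianization.of x = 1) (y : M) :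
    x * y = y * x := by
  have h1 : x ∈ commutator M := by
    rw [← Abelianization.ker_of]; exact hx
  exact (Subgroup.mem_center_iff.1 (h h1) y).symm

/-- The commutator depends on its second argument only modulo the commutator subgroup. -/
theorem N₂.comm_congr (h : N₂ M) {y y' : M}
    (hy : Abelianization.of y = Abelianization.of y') (x : M) : ⁅x, y⁆ = ⁅x, y'⁆ := by
  have h1 : ⁅x, y * y'⁻¹⁆ = 1 := by
    rw [commutatorElement_eq_one_iff_mul_comm]
    refine (h.of_ker_central ?_ x).symm
    rw [map_mul, map_inv, hy, mul_inv_cancel]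
  rw [h.mul_right, h.inv_right, mul_inv_eq_one] at h1
  exact h1

theorem of_eq_of_iff {x y : M} :
    Abelianization.of x = Abelianization.of y ↔ x * y⁻¹ ∈ commutator M := by
  rw [← Abelianization.ker_of, MonoidHom.mem_ker, map_mul, map_inv, mul_inv_eq_one]

theorem N₂.mul_pow (h : N₂ M) (x y : M) (m : ℕ) :
    (x * y) ^ m = x ^ m * y ^ m * ⁅y, x⁆ ^ m.choose 2 := by
  have hc : ∀ (k : ℕ) (a b z : M), Commute (⁅a, b⁆ ^ k) z := fun k a b z =>
    (show Commute ⁅a, b⁆ z from h.comm a b z).pow_left k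
  induction m with
  | zero => simp
  | succ m ih =>
    have h1 : y ^ m * x = ⁅y, x⁆ ^ m * (x * y ^ m) := by
      rw [← h.pow_left, commutatorElement_def]; group
    rw [pow_succ (x * y), ih, Nat.choose_succ_succ' m 1, Nat.choose_one_right, pow_add ⁅y, x⁆, pow_succ x m,
      pow_succ y m]
    calc x ^ m * y ^ m * ⁅y, x⁆ ^ m.choose 2 * (x * y)
        = x ^ m * y ^ m * (⁅y, x⁆ ^ m.choose 2 * (x * y)) := by group
      _ = x ^ m * (y ^ m * x) * y * ⁅y, x⁆ ^ m.choose 2 := by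
          rw [(hc _ y x (x * y)).eq]; simp only [mul_assoc]
      _ = x ^ m * (⁅y, x⁆ ^ m * (x * y ^ m * y)) * ⁅y, x⁆ ^ m.choose 2 := by
          rw [h1]; simp only [mul_assoc]
      _ = _ := by
          rw [(hc m y x (x * y ^ m * y)).eq]; simp only [mul_assoc]

theorem N₂.of_injective {L : Type u} [Group L] (h : N₂ M) (f : L →* M)
    (hf : Function.Injective f) : N₂ L := by
  rw [N₂_iff]
  intro x y z
  apply hf
  simp only [map_mul, map_commutatorElement, h.comm]

theorem N₂.of_surjective {L : Type u} [Group L] (h : N₂ M) (f : M →* L)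
    (hf : Function.Surjective f) : N₂ L := by
  rw [N₂_iff]
  intro x y z
  obtain ⟨x, rfl⟩ := hf x
  obtain ⟨y, rfl⟩ := hf y
  obtain ⟨z, rfl⟩ := hf z
  rw [← map_commutatorElement, ← map_mul, h.comm, map_mul]

theorem N₂.of_comm {L : Type u} [CommGroup L] : N₂ L := by
  rw [N₂_iff]
  intro x y z
  exact mul_comm _ _

theorem N₂.prod {L : Type v} [Group L] (h : N₂ M) (h' : N₂ L) : N₂ (M × L) := by
  rw [N₂_iff]
  intro x y z
  ext
  · exact h.comm _ _ _
  · exact h'.comm _ _ _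

theorem B.prod {m : ℕ} {L : Type u} [Group L] (h : B m M) (h' : B m L) : B m (M × L) :=
  fun _ => Prod.ext (h _) (h' _)

/-- This is what oddness of p is for: correction terms raised to the power C(p^n, 2), from
commutators or from a twist, die in exponent p^n. -/
theorem dvd_choose_two {p n : ℕ} (hodd : Odd p) : p ^ n ∣ (p ^ n).choose 2 := by
  obtain ⟨k, hk⟩ := hodd.pow (n := n)
  rw [Nat.choose_two_right, hk]
  refine ⟨k, ?_⟩
  rw [Nat.add_sub_cancel, show (2 * k + 1) * (2 * k) = (2 * k + 1) * k * 2 by ring,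
    Nat.mul_div_cancel _ two_pos]

/-- For odd `p`, the elements of order dividing `p ^ n` in a nil-2 group form a subgroup. -/
def N₂.torsion (h : N₂ M) {p : ℕ} (hodd : Odd p) (n : ℕ) : Subgroup M where
  carrier := {x | x ^ p ^ n = 1}
  one_mem' := one_pow _
  inv_mem' := fun hx => (inv_pow _ _).trans (inv_eq_one.2 hx)
  mul_mem' := fun {x y} hx hy => by
    change (x * y) ^ p ^ n = 1
    obtain ⟨k, hk⟩ := dvd_choose_two (n := n) hodd
    rw [h.mul_pow, hk, pow_mul, ← h.pow_left, hx, hy, commutatorElement_one_left, one_pow]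
    simp

theorem N₂.torsion_class (h : N₂ M) {p : ℕ} (hodd : Odd p) (n : ℕ) :
    N₂B (p ^ n) (h.torsion hodd n) :=
  ⟨h.of_injective (Subgroup.subtype _) (Subgroup.subtype_injective _),
    fun x => Subtype.ext x.2⟩

end Basic

/-! ### Deforming a group by a bimultiplicative 2-cocycle. -/

/-- A bimultiplicative central map `P × P → P` that vanishes on its own values. -/
structure Twist (P : Type u) [Group P] where
  toFun : P → P → P
  mul_left : ∀ x y z, toFun (x * y) z = toFun x z * toFun y z
  mul_right : ∀ x y z, toFun x (y * z) = toFun x y * toFun x z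
  central : ∀ x y z, toFun x y * z = z * toFun x y
  self_left : ∀ x y z, toFun (toFun x y) z = 1
  self_right : ∀ x y z, toFun z (toFun x y) = 1

/-- The group `P` with multiplication deformed to `x y β(x, y)`. -/
@[ext]
structure Twisted {P : Type u} [Group P] (β : Twist P) where
  val : P

section Twisted

variable {P : Type u} [Group P] (β : Twist P)

/-- A twist in its first variable. -/
def Twist.leftHom (z : P) : P →* P :=
  MonoidHom.mk' (fun x => β.toFun x z) fun a b => β.mul_left a b z

/-- A twist in its second variable. -/
def Twist.rightHom (z : P) : P →* P :=
  MonoidHom.mk' (fun x => β.toFun z x) fun a b => β.mul_right z a b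

theorem Twist.one_left (z : P) : β.toFun 1 z = 1 := map_one (β.leftHom z)

theorem Twist.pow_left (x z : P) (m : ℕ) : β.toFun (x ^ m) z = β.toFun x z ^ m :=
  map_pow (β.leftHom z) x m

theorem Twist.inv_left (x z : P) : β.toFun x⁻¹ z = (β.toFun x z)⁻¹ :=
  map_inv (β.leftHom z) x

theorem Twist.inv_right (x z : P) : β.toFun z x⁻¹ = (β.toFun z x)⁻¹ :=
  map_inv (β.rightHom z) x

theorem Twist.comm_left (x y z : P) : β.toFun ⁅x, y⁆ z = 1 := by
  have h : β.toFun ⁅x, y⁆ z = ⁅β.toFun x z, β.toFun y z⁆ :=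
    map_commutatorElement (β.leftHom z) x y
  rw [h, commutatorElement_eq_one_iff_mul_comm]
  exact β.central _ _ _

theorem Twist.comm_right (x y z : P) : β.toFun z ⁅x, y⁆ = 1 := by
  have h : β.toFun z ⁅x, y⁆ = ⁅β.toFun z x, β.toFun z y⁆ :=
    map_commutatorElement (β.rightHom z) x y
  rw [h, commutatorElement_eq_one_iff_mul_comm]
  exact β.central _ _ _

instance : Mul (Twisted β) := ⟨fun x y => ⟨x.val * y.val * β.toFun x.val y.val⟩⟩
instance : One (Twisted β) := ⟨⟨1⟩⟩
instance : Inv (Twisted β) := ⟨fun x => ⟨x.val⁻¹ * β.toFun x.val x.val⟩⟩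

theorem Twisted.val_mul (x y : Twisted β) :
    (x * y).val = x.val * y.val * β.toFun x.val y.val := rfl

theorem Twisted.val_one : (1 : Twisted β).val = 1 := rfl

theorem Twisted.val_inv (x : Twisted β) : (x⁻¹).val = x.val⁻¹ * β.toFun x.val x.val := rfl

instance : Group (Twisted β) := Group.ofLeftAxioms
  (fun x y z => by
    ext
    simp only [Twisted.val_mul, β.mul_left, β.mul_right, β.self_left, β.self_right, mul_one]
    rw [mul_assoc (x.val * y.val) _ z.val, β.central _ _ z.val]
    simp only [mul_assoc]
    congr 3
    rw [← mul_assoc, β.central y.val z.val])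
  (fun x => by
    ext
    simp only [Twisted.val_mul, Twisted.val_one, one_mul, β.one_left, mul_one])
  (fun x => by
    ext
    simp only [Twisted.val_mul, Twisted.val_one, Twisted.val_inv, β.mul_left, β.inv_left,
      β.self_left, mul_one]
    rw [mul_assoc, mul_assoc, ← mul_assoc _ x.val, β.central _ _ x.val, mul_assoc, mul_inv_cancel]
    simp)

/-- The deformation changes commutators by the antisymmetrization of β. Every later construction
chooses β to prescribe the commutators of chosen elements. -/
theorem Twisted.val_commutator (x y : Twisted β) :
    ⁅x, y⁆.val = ⁅x.val, y.val⁆ * (β.toFun x.val y.val * (β.toFun y.val x.val)⁻¹) := by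
  have key : x * y =
      ⟨⁅x.val, y.val⁆ * (β.toFun x.val y.val * (β.toFun y.val x.val)⁻¹)⟩ * (y * x) := by
    ext
    have hk : ∀ z, β.toFun (⁅x.val, y.val⁆ * (β.toFun x.val y.val * (β.toFun y.val x.val)⁻¹)) z
        = 1 := fun z => by
      simp only [β.mul_left, β.comm_left, β.self_left, β.inv_left, inv_one, mul_one]
    have e : ⁅x.val, y.val⁆ * (y.val * x.val) = x.val * y.val := by
      rw [commutatorElement_def]; group
    simp only [Twisted.val_mul, hk, mul_one]
    have c1 : Commute (β.toFun x.val y.val * (β.toFun y.val x.val)⁻¹)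
        (y.val * x.val * β.toFun y.val x.val) :=
      Commute.mul_left (β.central _ _ _) (Commute.inv_left (β.central _ _ _))
    have c2 : Commute (β.toFun x.val y.val) (β.toFun y.val x.val)⁻¹ := β.central _ _ _
    rw [mul_assoc ⁅_, _⁆, c1.eq, c2.eq, mul_assoc _ (β.toFun y.val x.val), mul_inv_cancel_left,
      ← mul_assoc, e]
  have h2 : ⁅x, y⁆ =
      (⟨⁅x.val, y.val⁆ * (β.toFun x.val y.val * (β.toFun y.val x.val)⁻¹)⟩ : Twisted β) := by
    have : ⁅x, y⁆ = x * y * (y * x)⁻¹ := by rw [commutatorElement_def]; group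
    rw [this, key, mul_inv_cancel_right]
  rw [h2]

theorem Twisted.val_pow (x : Twisted β) (m : ℕ) :
    (x ^ m).val = x.val ^ m * β.toFun x.val x.val ^ m.choose 2 := by
  induction m with
  | zero => simp [Twisted.val_one]
  | succ m ih =>
    rw [pow_succ, Twisted.val_mul, ih, β.mul_left, β.pow_left, β.pow_left, β.self_left, one_pow,
      mul_one, Nat.choose_succ_succ' m 1, Nat.choose_one_right, pow_add (β.toFun _ _),
      pow_succ x.val m]
    have c1 : Commute (β.toFun x.val x.val ^ m.choose 2) x.val :=
      Commute.pow_left (β.central _ _ _) _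
    rw [mul_assoc (x.val ^ m), c1.eq]
    simp only [mul_assoc]
    rw [((Commute.refl (β.toFun x.val x.val)).pow_pow _ _).eq]

theorem Twisted.N₂ (h : N₂ P) : N₂ (Twisted β) := by
  rw [N₂_iff]
  intro x y z
  rw [← commutatorElement_eq_one_iff_mul_comm]
  ext
  simp only [Twisted.val_commutator, Twisted.val_one, β.mul_left, β.mul_right, β.comm_left,
    β.comm_right, β.self_left, β.self_right, β.inv_left, β.inv_right, inv_one, mul_one]
  rw [commutatorElement_eq_one_iff_mul_comm]
  exact Commute.mul_left (h.comm _ _ _)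
    (Commute.mul_left (β.central _ _ _) (Commute.inv_left (β.central _ _ _)))

theorem Twisted.B {p n : ℕ} (hodd : Odd p) (h : B (p ^ n) P) : B (p ^ n) (Twisted β) := by
  intro x
  obtain ⟨k, hk⟩ := dvd_choose_two (n := n) hodd
  ext
  rw [Twisted.val_pow, h, hk, pow_mul, h, one_pow, mul_one, Twisted.val_one]

end Twisted

/-! ### Splitting of bounded pure subgroups. -/

/-- A pure embedding of a group of exponent `p ^ n` into an abelian group splits. -/
theorem exists_add_retraction {A V : Type u} [AddCommGroup A] [AddCommGroup V] {p n : ℕ}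
    (hp : p.Prime) (j : A →+ V) (hA : ∀ a : A, p ^ n • a = 0)
    (hpure : ∀ (i : ℕ) (v : V) (a : A), p ^ i • v = j a → ∃ a', a = p ^ i • a') :
    ∃ π : V →+ A, ∀ a, π (j a) = a := by
  -- The subgroups modulo which A remains purely embedded. A maximal one turns out to be a
  -- complement of the image of A.
  let S : Set (AddSubgroup V) :=
    {U | ∀ (i : ℕ) (v : V) (a : A), p ^ i • v - j a ∈ U → ∃ a', a = p ^ i • a'}
  obtain ⟨U, -, hU⟩ := zorn_le_nonempty₀ S (by
    intro c hc hchain y hy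
    refine ⟨sSup c, ?_, fun z hz => le_sSup hz⟩
    intro i v a hv
    obtain ⟨U, hUc, hv⟩ := (AddSubgroup.mem_sSup_of_directedOn ⟨y, hy⟩ hchain.directedOn).1 hv
    exact hc hUc i v a hv) ⊥ (by
    intro i v a hv
    exact hpure i v a (sub_eq_zero.1 (AddSubgroup.mem_bot.1 hv)))
  have hUS : ∀ (i : ℕ) (v : V) (a : A), p ^ i • v - j a ∈ U → ∃ a', a = p ^ i • a' := hU.prop
  have huniq : ∀ a : A, j a ∈ U → a = 0 := by
    intro a ha
    obtain ⟨a', rfl⟩ := hUS n 0 a (by simpa using ha)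
    exact hA a'
  have hext : ∀ x : V, (∀ (i : ℕ) (y : V) (a : A) (c : ℤ),
      p ^ i • y - j a - c • x ∈ U → ∃ a', a = p ^ i • a') → x ∈ U := by
    intro x hx
    have hle : U ⊔ AddSubgroup.zmultiples x ≤ U := by
      refine hU.le_of_ge ?_ le_sup_left
      intro i y a hy
      obtain ⟨u, hu, z, hz, huz⟩ := AddSubgroup.mem_sup.1 hy
      obtain ⟨c, rfl⟩ := AddSubgroup.mem_zmultiples_iff.1 hz
      refine hx i y a c ?_
      rw [← huz, add_sub_cancel_right]
      exact hu
    exact hle (AddSubgroup.mem_sup_right (AddSubgroup.mem_zmultiples x))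
  have hn : ∀ v : V, p ^ n • v ∈ U := by
    intro v
    apply hext
    intro i y a c h
    rcases le_total i n with hin | hin
    · refine hUS i (y - (c * (p : ℤ) ^ (n - i)) • v) a ?_
      convert h using 1
      obtain ⟨k, rfl⟩ := Nat.exists_eq_add_of_le hin
      simp only [Nat.add_sub_cancel_left, ← natCast_zsmul]
      push_cast
      rw [pow_add]
      module
    · obtain ⟨k, rfl⟩ := Nat.exists_eq_add_of_le hin
      have h0 : a = 0 := by
        obtain ⟨a', rfl⟩ := hUS n (p ^ k • y - c • v) a (by
          convert h using 1
          simp only [← natCast_zsmul]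
          push_cast
          rw [pow_add]
          module)
        exact hA a'
      exact ⟨0, by rw [h0, smul_zero]⟩
  -- Take the least k with p^k V inside U + j(A). If k > 0, purity produces x with p^k x in U but
  -- p^(k-1) x outside U + j(A). Such an x satisfies the criterion `hext`, so lies in U, which is
  -- absurd.
  have hcover : ∀ v : V, v ∈ U ⊔ j.range := by
    have hex : ∃ k, ∀ v : V, p ^ k • v ∈ U ⊔ j.range :=
      ⟨n, fun v => AddSubgroup.mem_sup_left (hn v)⟩
    classical
    obtain ⟨k, hk, hmin⟩ : ∃ k, (∀ v : V, p ^ k • v ∈ U ⊔ j.range) ∧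
        ∀ l < k, ¬ ∀ v : V, p ^ l • v ∈ U ⊔ j.range :=
      ⟨Nat.find hex, Nat.find_spec hex, fun l hl => Nat.find_min hex hl⟩
    rcases Nat.eq_zero_or_pos k with rfl | hkpos
    · simpa using hk
    exfalso
    obtain ⟨v, hv⟩ := not_forall.1 (hmin (k - 1) (by omega))
    obtain ⟨u, hu, _, ⟨a, rfl⟩, hua⟩ := AddSubgroup.mem_sup.1 (hk v)
    obtain ⟨a', rfl⟩ := hUS k v a (by rw [← hua, add_sub_cancel_right]; exact hu)
    have hxk : p ^ k • (v - j a') ∈ U := by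
      rw [smul_sub, ← hua, map_nsmul, add_sub_cancel_right]; exact hu
    have hxk' : p ^ (k - 1) • (v - j a') ∉ U ⊔ j.range := by
      intro h
      refine hv ?_
      have := add_mem h (AddSubgroup.mem_sup_right (S := U)
        (AddMonoidHom.mem_range.2 ⟨p ^ (k - 1) • a', rfl⟩))
      rwa [smul_sub, map_nsmul, sub_add_cancel] at this
    generalize v - j a' = x at hxk hxk'
    refine hxk' ((AddSubgroup.mem_sup_left (nsmul_mem (hext x ?_) _)))
    intro i y b c h
    by_cases hci : ((p ^ i : ℕ) : ℤ) ∣ c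
    · obtain ⟨d, rfl⟩ := hci
      refine hUS i (y - d • x) b ?_
      convert h using 1
      simp only [← natCast_zsmul]
      module
    by_cases hck : ((p ^ k : ℕ) : ℤ) ∣ c
    · obtain ⟨d, rfl⟩ := hck
      refine hUS i y b ?_
      have := add_mem h (zsmul_mem hxk d)
      convert this using 1
      simp only [← natCast_zsmul]
      module
    exfalso
    -- Here gcd(c, p^i) = p^l with l < i and l < k. Bézout writes p^l x modulo U + j(A) as a
    -- multiple of p^(l+1), so p^(k-1) x lies in p^k V + U + j(A), hence in U + j(A).
    obtain ⟨l, hli, hl⟩ := (Nat.dvd_prime_pow hp).1 (Int.gcd_dvd_natAbs_right c (p ^ i : ℕ))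
    have hlc : ((p ^ l : ℕ) : ℤ) ∣ c := hl ▸ Int.gcd_dvd_left _ _
    have hli' : l < i := lt_of_le_of_ne hli fun e => hci (e ▸ hlc)
    have hlk : l < k := by
      by_contra hcon
      exact hck ((Int.natCast_dvd_natCast.2 (pow_dvd_pow p (not_lt.1 hcon))).trans hlc)
    have hbez := Int.gcd_eq_gcd_ab c (p ^ i : ℕ)
    rw [hl] at hbez
    set α := Int.gcdA c (p ^ i : ℕ)
    set β := Int.gcdB c (p ^ i : ℕ)
    obtain ⟨d, rfl⟩ := Nat.exists_eq_add_of_lt hlk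
    obtain ⟨e, rfl⟩ := Nat.exists_eq_add_of_lt hli'
    refine hxk' ?_
    have e1 : p ^ (l + d + 1 - 1) • x =
        p ^ (l + d + 1) • ((p ^ e : ℕ) • (α • y + β • x)) +
        (-((p : ℤ) ^ d * α)) • (p ^ (l + e + 1) • y - j b - c • x) +
        j ((-((p : ℤ) ^ d * α)) • b) := by
      rw [map_zsmul, Nat.add_sub_cancel]
      simp only [← natCast_zsmul]
      have e2 : ((p ^ (l + d) : ℕ) : ℤ) = (p : ℤ) ^ d * (p ^ l : ℕ) := by
        push_cast; ring
      rw [e2, hbez]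
      push_cast
      module
    rw [e1]
    exact add_mem (add_mem (hk _) (AddSubgroup.mem_sup_left (zsmul_mem h _)))
      (AddSubgroup.mem_sup_right ⟨_, rfl⟩)
  have hsol : ∀ v : V, ∃ a : A, v - j a ∈ U := by
    intro v
    obtain ⟨u, hu, _, ⟨a, rfl⟩, h⟩ := AddSubgroup.mem_sup.1 (hcover v)
    exact ⟨a, by rw [← h, add_sub_cancel_right]; exact hu⟩
  choose f hf using hsol
  have hfu : ∀ v a, v - j a ∈ U → f v = a := by
    intro v a ha
    have := huniq (f v - a) (by
      have := sub_mem ha (hf v)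
      rw [map_sub]
      convert this using 1
      abel)
    exact sub_eq_zero.1 this
  refine ⟨AddMonoidHom.mk' f fun v w => hfu _ _ ?_, fun a => hfu _ _ ?_⟩
  · have := add_mem (hf v) (hf w)
    rw [map_add]
    convert this using 1
    abel
  · rw [sub_self]; exact zero_mem _

theorem exists_retraction {A V : Type u} [CommGroup A] [CommGroup V] {p n : ℕ}
    (hp : p.Prime) (j : A →* V) (hA : ∀ a : A, a ^ p ^ n = 1)
    (hpure : ∀ (i : ℕ) (v : V) (a : A), v ^ p ^ i = j a → ∃ a', a = a' ^ p ^ i) :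
    ∃ π : V →* A, ∀ a, π (j a) = a := by
  obtain ⟨π, hπ⟩ := exists_add_retraction (A := Additive A) (V := Additive V) hp
    (MonoidHom.toAdditive j) hA hpure
  exact ⟨MonoidHom.toAdditive.symm π, hπ⟩

/-! ### The commutator pairing on the abelianization. -/

section Pairing

variable {M : Type u} [Group M]

theorem ab_surjective : Function.Surjective (Abelianization.of : M →* Abelianization M) :=
  QuotientGroup.mk_surjective

/-- The commutator pairing on the abelianization of a group of class at most two. -/
noncomputable def commPair (a b : Abelianization M) : M :=
  ⁅Function.surjInv ab_surjective a, Function.surjInv ab_surjective b⁆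

theorem N₂.commPair_of (h : N₂ M) (x y : M) :
    commPair (Abelianization.of x) (Abelianization.of y) = ⁅x, y⁆ := by
  unfold commPair
  rw [h.comm_congr (Function.surjInv_eq ab_surjective (Abelianization.of y)),
    ← commutatorElement_inv,
    h.comm_congr (Function.surjInv_eq ab_surjective (Abelianization.of x)),
    commutatorElement_inv]

theorem N₂.commPair_mul_left (h : N₂ M) (a b c : Abelianization M) :
    commPair (a * b) c = commPair a c * commPair b c := by
  obtain ⟨a, rfl⟩ := ab_surjective a
  obtain ⟨b, rfl⟩ := ab_surjective b
  obtain ⟨c, rfl⟩ := ab_surjective c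
  rw [← map_mul, h.commPair_of, h.commPair_of, h.commPair_of, h.mul_left]

theorem N₂.commPair_mul_right (h : N₂ M) (a b c : Abelianization M) :
    commPair a (b * c) = commPair a b * commPair a c := by
  obtain ⟨a, rfl⟩ := ab_surjective a
  obtain ⟨b, rfl⟩ := ab_surjective b
  obtain ⟨c, rfl⟩ := ab_surjective c
  rw [← map_mul, h.commPair_of, h.commPair_of, h.commPair_of, h.mul_right]

theorem map_commPair (e : M →* Abelianization M) (a b : Abelianization M) :
    e (commPair a b) = 1 := by
  unfold commPair
  rw [map_commutatorElement, commutatorElement_eq_one_iff_mul_comm, mul_comm]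

theorem N₂.commPair_one_left (h : N₂ M) (a : Abelianization M) : commPair 1 a = 1 := by
  have := h.commPair_mul_left 1 1 a
  rwa [mul_one, left_eq_mul] at this

theorem N₂.commPair_one_right (h : N₂ M) (a : Abelianization M) : commPair a 1 = 1 := by
  have := h.commPair_mul_right a 1 1
  rwa [mul_one, left_eq_mul] at this

/-- The twist `(x, y) ↦ ⁅e x, f y⁆`. -/
noncomputable def Twist.ofPair (h : N₂ M) (e f : M →* Abelianization M) : Twist M where
  toFun x y := commPair (e x) (f y)
  mul_left x y z := by rw [map_mul, h.commPair_mul_left]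
  mul_right x y z := by rw [map_mul, h.commPair_mul_right]
  central x y z := h.comm _ _ _
  self_left x y z := by rw [map_commPair, h.commPair_one_left]
  self_right x y z := by rw [map_commPair, h.commPair_one_right]

end Pairing

/-! ### The root condition. -/

/-- Each element that is not a `p ^ i`-th power modulo the commutator subgroup has a witness that
it acquires no `p ^ i`-th root modulo the center in any nil-2 overgroup. -/
def RootObstructed (p n : ℕ) (G : Type u) [Group G] : Prop :=
  ∀ i : ℕ, 1 ≤ i → i ≤ n - 1 → ∀ g : G,
    g ∈ powSubgroup (p ^ i) G ⊔ commutator G ∨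
      ∃ (c : ℕ) (y : G), 0 < c ∧
        Abelianization.of (y ^ p ^ i) = Abelianization.of (g ^ c) ∧ y⁻¹ * g⁻¹ * y * g ≠ 1

theorem mem_powSubgroup_sup {G : Type u} [Group G] {q : ℕ} {g : G} :
    g ∈ powSubgroup q G ⊔ commutator G ↔ ∃ a : Abelianization G, Abelianization.of g = a ^ q := by
  constructor
  · intro hg
    have hle : powSubgroup q G ⊔ commutator G ≤
        (powMonoidHom q : Abelianization G →* Abelianization G).range.comap Abelianization.of := by
      refine sup_le ((Subgroup.closure_le _).2 ?_) ?_
      · rintro _ ⟨x, rfl⟩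
        exact ⟨Abelianization.of x, (map_pow _ _ _).symm⟩
      · intro x hx
        rw [← Abelianization.ker_of] at hx
        exact ⟨1, by rw [map_one]; exact (MonoidHom.mem_ker.1 hx).symm⟩
    obtain ⟨a, ha⟩ := hle hg
    exact ⟨a, ha.symm⟩
  · rintro ⟨a, ha⟩
    obtain ⟨x, rfl⟩ := ab_surjective a
    rw [← map_pow] at ha
    have h2 := of_eq_of_iff.1 ha.symm
    have h3 : g = (x ^ q * g⁻¹)⁻¹ * x ^ q := by group
    rw [h3]
    exact mul_mem (Subgroup.mem_sup_right (inv_mem h2))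
      (Subgroup.mem_sup_left (Subgroup.subset_closure ⟨x, rfl⟩))

theorem commute_of_inv_mul {G : Type u} [Group G] {y g : G} :
    y⁻¹ * g⁻¹ * y * g = 1 ↔ Commute y g := by
  rw [mul_assoc, ← mul_inv_rev, inv_mul_eq_one, eq_comm]
  rfl

theorem map_of_congr {G K : Type u} [Group G] [Group K] (φ : G →* K) {x y : G}
    (h : Abelianization.of x = Abelianization.of y) :
    Abelianization.of (φ x) = Abelianization.of (φ y) := by
  rw [← Abelianization.map_of, h, Abelianization.map_of]

theorem map_of_eq_one {G K : Type u} [Group G] [Group K] (φ : G →* K) {x : G}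
    (h : x ∈ commutator G) : Abelianization.of (φ x) = 1 := by
  rw [← Abelianization.ker_of, MonoidHom.mem_ker] at h
  rw [← Abelianization.map_of, h, map_one]

/-! ### From the root condition to strong embeddings. -/

section Amalgam

variable {G : Type u} [Group G] {p n : ℕ}

theorem pure_of_rootObstructed (hG : N₂B (p ^ n) G) (hZ : Subgroup.center G = commutator G)
    (hR : RootObstructed p n G) {K : Type u} [Group K] (hK : N₂ K) (φ : G →* K)
    (hφ : Function.Injective φ) (i : ℕ) (v : Abelianization K) (a : Abelianization G)
    (hv : v ^ p ^ i = Abelianization.map φ a) : ∃ a', a = a' ^ p ^ i := by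
  obtain ⟨x, rfl⟩ := ab_surjective v
  obtain ⟨g, rfl⟩ := ab_surjective a
  rw [Abelianization.map_of, ← map_pow] at hv
  have key : ∀ y : K, ⁅y, φ g⁆ = ⁅y ^ p ^ i, x⁆ := fun y => by
    rw [← hK.comm_congr hv, hK.pow_right, hK.pow_left]
  rcases Nat.eq_zero_or_pos i with rfl | hi
  · exact ⟨Abelianization.of g, by simp⟩
  rcases le_or_gt i (n - 1) with hin | hin
  · rcases hR i hi hin g with h | ⟨c, y, hc, hy, hyg⟩
    · exact mem_powSubgroup_sup.1 h
    exfalso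
    refine hyg (commute_of_inv_mul.2 ?_)
    have h1 : ⁅φ y, φ g⁆ = 1 := by
      rw [key, ← commutatorElement_inv, ← map_pow, hK.comm_congr (map_of_congr φ hy), map_pow,
        hK.pow_right, ← hK.comm_congr hv, hK.pow_right, commutatorElement_self, one_pow, one_pow,
        inv_one]
    apply hφ
    rw [map_mul, map_mul]
    exact commutatorElement_eq_one_iff_mul_comm.1 h1
  -- For i ≥ n every y in G has y^(p^i) = 1, so `key` makes g central, hence trivial modulo G'.
  · have hg : g ∈ Subgroup.center G := by
      rw [Subgroup.mem_center_iff]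
      intro y
      apply hφ
      rw [map_mul, map_mul]
      refine commutatorElement_eq_one_iff_mul_comm.1 ?_
      obtain ⟨k, rfl⟩ := Nat.exists_eq_add_of_le (show n ≤ i by omega)
      rw [key, pow_add, pow_mul, ← map_pow, hG.2, map_one, one_pow, commutatorElement_one_left]
    rw [hZ, ← Abelianization.ker_of] at hg
    exact ⟨1, by rw [one_pow]; exact hg⟩

theorem exists_abelian_retraction (hp : p.Prime) (hG : N₂B (p ^ n) G)
    (hZ : Subgroup.center G = commutator G)
    (hR : RootObstructed p n G) {K : Type u} [Group K] (hK : N₂ K) (φ : G →* K)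
    (hφ : Function.Injective φ) :
    ∃ π : K →* Abelianization G, ∀ g, π (φ g) = Abelianization.of g := by
  obtain ⟨π, hπ⟩ := exists_retraction hp (Abelianization.map φ) (fun a => by
    obtain ⟨g, rfl⟩ := ab_surjective a
    rw [← map_pow, hG.2, map_one]) (pure_of_rootObstructed hG hZ hR hK φ hφ)
  exact ⟨π.comp Abelianization.of, fun g => by
    rw [MonoidHom.comp_apply, ← Abelianization.map_of, hπ]⟩

/-- If `G` is a retract of both factors modulo its commutator subgroup, then the amalgam embeds
strongly into a quotient of a twisted product. -/
theorem stronglyEmbeddable_of_retractions {K₁ K₂ : Type u} [Group K₁] [Group K₂]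
    (h₁ : N₂ K₁) (h₂ : N₂ K₂) (φ₁ : G →* K₁) (φ₂ : G →* K₂)
    (hφ₁ : Function.Injective φ₁) (hφ₂ : Function.Injective φ₂)
    (π₁ : K₁ →* Abelianization G) (hπ₁ : ∀ g, π₁ (φ₁ g) = Abelianization.of g)
    (π₂ : K₂ →* Abelianization G) (hπ₂ : ∀ g, π₂ (φ₂ g) = Abelianization.of g) :
    StronglyEmbeddable N₂ φ₁ φ₂ := by
  have hP : N₂ (K₁ × K₂) := h₁.prod h₂
  let i₁ : K₁ →* K₁ × K₂ := MonoidHom.inl K₁ K₂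
  let i₂ : K₂ →* K₁ × K₂ := MonoidHom.inr K₁ K₂
  -- For g, h lifting π₁ x and π₂ y', the pair e, f gives the twist ([x,h], [g, y'h⁻¹]). After
  -- gluing this is [x,h][g,y'][g,h]⁻¹, the commutator obtained when elements of K₁ and K₂ with
  -- trivial retraction commute.
  let e : K₁ × K₂ →* Abelianization (K₁ × K₂) :=
    (Abelianization.of.comp i₁ * (Abelianization.map (i₂.comp φ₂)).comp π₁).comp
      (MonoidHom.fst K₁ K₂)
  let f : K₁ × K₂ →* Abelianization (K₁ × K₂) :=
    ((Abelianization.map (i₁.comp φ₁)).comp π₂ * (Abelianization.of.comp i₂ *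
      ((Abelianization.map (i₂.comp φ₂)).comp π₂)⁻¹)).comp (MonoidHom.snd K₁ K₂)
  let β := Twist.ofPair hP e f
  have hβ : ∀ (x x' : K₁) (y y' : K₂) (g h : G), π₁ x = Abelianization.of g →
      π₂ y' = Abelianization.of h →
      β.toFun (x, y) (x', y') = (⁅x, φ₁ h⁆, ⁅φ₂ g, y'⁆ * ⁅φ₂ g, φ₂ h⁆⁻¹) := by
    intro x x' y y' g h hx hy
    have he : e (x, y) = Abelianization.of (x, φ₂ g) := by
      change Abelianization.of (i₁ x) * Abelianization.map (i₂.comp φ₂) (π₁ x) = _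
      rw [hx, Abelianization.map_of, ← map_mul]
      simp [i₁, i₂]
    have hf : f (x', y') = Abelianization.of (φ₁ h, y' * (φ₂ h)⁻¹) := by
      change Abelianization.map (i₁.comp φ₁) (π₂ y') * (Abelianization.of (i₂ y') *
        (Abelianization.map (i₂.comp φ₂) (π₂ y'))⁻¹) = _
      rw [hy, Abelianization.map_of, Abelianization.map_of, ← map_inv, ← map_mul, ← map_mul]
      simp [i₁, i₂]
    change commPair (e (x, y)) (f (x', y')) = _
    rw [he, hf, hP.commPair_of]
    ext
    · rfl
    · change ⁅φ₂ g, y' * (φ₂ h)⁻¹⁆ = _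
      rw [h₂.mul_right, h₂.inv_right]
  have hβ1 : ∀ (x x' : K₁) (y : K₂) (h : G), β.toFun (x, y) (x', φ₂ h) = (⁅x, φ₁ h⁆, 1) := by
    intro x x' y h
    obtain ⟨g, hg⟩ := ab_surjective (π₁ x)
    rw [hβ x x' y (φ₂ h) g h hg.symm (hπ₂ h), mul_inv_cancel]
  have hβ2 : ∀ (x x' : K₁) (y : K₂), β.toFun (x, y) (x', 1) = 1 := by
    intro x x' y
    have := hβ1 x x' y 1
    rw [map_one, map_one, commutatorElement_one_right] at this
    exact this
  have hβ3 : ∀ (g : G) (x : K₁) (y y' : K₂) (h : G), π₂ y' = Abelianization.of h →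
      β.toFun (φ₁ g, y) (x, y') = (φ₁ ⁅g, h⁆, ⁅φ₂ g, y'⁆ * (φ₂ ⁅g, h⁆)⁻¹) := by
    intro g x y y' h hy
    rw [hβ (φ₁ g) x y y' g h (hπ₁ g) hy, map_commutatorElement, map_commutatorElement]
  have hd : ∀ (g h : G) (y : K₂) (x : K₁),
      β.toFun (φ₁ g, y) (x, φ₂ h) = (φ₁ ⁅g, h⁆, 1) := by
    intro g h y x
    rw [hβ1, map_commutatorElement]
  have hG : N₂ G := h₁.of_injective φ₁ hφ₁
  let N : Subgroup (Twisted β) :=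
    { carrier := {X | ∃ g, X.val = (φ₁ g, φ₂ g⁻¹)}
      one_mem' := ⟨1, by rw [Twisted.val_one, inv_one, map_one, map_one]; rfl⟩
      mul_mem' := by
        rintro X Y ⟨g, hX⟩ ⟨h, hY⟩
        -- The twist contributes [g,h]⁻¹ in the first coordinate, turning gh into hg and matching
        -- g⁻¹h⁻¹ = (hg)⁻¹ in the second.
        refine ⟨h * g, ?_⟩
        rw [Twisted.val_mul, hX, hY, hd, hG.inv_right]
        ext
        · change φ₁ g * φ₁ h * φ₁ ⁅g, h⁆⁻¹ = _
          rw [← map_mul, ← map_mul, commutatorElement_inv, ← hG.comm, commutatorElement_def]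
          group
        · change φ₂ g⁻¹ * φ₂ h⁻¹ * 1 = _
          rw [mul_one, ← map_mul, mul_inv_rev]
      inv_mem' := by
        rintro X ⟨g, hX⟩
        refine ⟨g⁻¹, ?_⟩
        rw [Twisted.val_inv, hX, hd, hG.inv_right, commutatorElement_self, inv_one, map_one]
        ext
        · change (φ₁ g)⁻¹ * 1 = _
          rw [mul_one, map_inv]
        · change (φ₂ g⁻¹)⁻¹ * 1 = _
          rw [mul_one, ← map_inv] }
  have hN : N.Normal := by
    constructor
    rintro X ⟨g, hX⟩ Y
    have : ⁅Y, X⁆ ∈ N := by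
      obtain ⟨⟨x, y⟩⟩ := Y
      obtain ⟨s, hs⟩ := ab_surjective (π₂ y)
      refine ⟨⁅g, s⁆⁻¹, ?_⟩
      rw [Twisted.val_commutator, hX, hβ1, hβ3 g x _ y s hs.symm]
      ext
      · change ⁅x, φ₁ g⁆ * (⁅x, φ₁ g⁻¹⁆ * (φ₁ ⁅g, s⁆)⁻¹) = _
        rw [map_inv φ₁ g, h₁.inv_right, mul_inv_cancel_left, map_inv]
      · change ⁅y, φ₂ g⁻¹⁆ * (1 * (⁅φ₂ g, y⁆ * (φ₂ ⁅g, s⁆)⁻¹)⁻¹) = _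
        rw [map_inv φ₂ g, h₂.inv_right, commutatorElement_inv, one_mul, mul_inv_rev, inv_inv,
          ← mul_assoc, h₂.comm, mul_inv_cancel_right, inv_inv]
    have h3 := N.mul_mem this ⟨g, hX⟩
    rwa [commutatorElement_def, inv_mul_cancel_right] at h3
  let l₁ : K₁ →* Twisted β := MonoidHom.mk' (fun x => ⟨(x, 1)⟩) fun x x' => by
    ext1
    rw [Twisted.val_mul, hβ2, mul_one]
    simp
  let l₂ : K₂ →* Twisted β := MonoidHom.mk' (fun y => ⟨(1, y)⟩) fun y y' => by
    ext1
    obtain ⟨s, hs⟩ := ab_surjective (π₂ y')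
    have := hβ3 1 1 y y' s hs.symm
    simp only [map_one, commutatorElement_one_left, inv_one, mul_one] at this
    rw [Twisted.val_mul, this]
    simp
  have hval : ∀ a b, ((l₂ b)⁻¹ * l₁ a).val = (a, b⁻¹) := by
    intro a b
    rw [← map_inv, Twisted.val_mul]
    change (1, b⁻¹) * (a, 1) * β.toFun (1, b⁻¹) (a, 1) = _
    rw [hβ2, mul_one, Prod.mk_mul_mk, one_mul, mul_one]
  -- This gives the strong intersection property, and injectivity of both maps by taking a or b
  -- trivial.
  have key : ∀ a b, QuotientGroup.mk' N (l₁ a) = QuotientGroup.mk' N (l₂ b) →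
      ∃ g, a = φ₁ g ∧ b = φ₂ g := by
    intro a b hab
    obtain ⟨g, hg⟩ := QuotientGroup.eq.1 hab.symm
    rw [hval, Prod.ext_iff, map_inv, inv_inj] at hg
    exact ⟨g, hg⟩
  refine ⟨Twisted β ⧸ N, inferInstance, (QuotientGroup.mk' N).comp l₁, (QuotientGroup.mk' N).comp l₂,
    (Twisted.N₂ β hP).of_surjective _ (QuotientGroup.mk'_surjective N), ?_, ?_, ?_, ?_⟩
  · rw [injective_iff_map_eq_one]
    intro a ha
    obtain ⟨g, rfl, hg⟩ := key a 1 (by rw [map_one, map_one]; exact ha)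
    rw [hφ₂ (hg.symm.trans (map_one φ₂).symm), map_one]
  · rw [injective_iff_map_eq_one]
    intro b hb
    obtain ⟨g, hg, rfl⟩ := key 1 b (by rw [map_one, map_one]; exact hb.symm)
    rw [hφ₁ (hg.symm.trans (map_one φ₁).symm), map_one]
  · ext g
    have : (l₂ (φ₂ g))⁻¹ * l₁ (φ₁ g) ∈ N := ⟨g, by rw [hval, map_inv]⟩
    exact (QuotientGroup.eq.2 this).symm
  · intro a b hab
    obtain ⟨g, rfl, rfl⟩ := key a b hab
    exact ⟨⟨g, rfl⟩, ⟨g, rfl⟩⟩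

theorem isStrongAmalgamationBase_of_rootObstructed (hp : p.Prime) (hG : N₂B (p ^ n) G)
    (hZ : Subgroup.center G = commutator G) (hR : RootObstructed p n G) :
    IsStrongAmalgamationBase N₂ G := by
  refine ⟨hG.1, ?_⟩
  intro K₁ K₂ _ _ φ₁ φ₂ h₁ h₂ hφ₁ hφ₂
  obtain ⟨π₁, hπ₁⟩ := exists_abelian_retraction hp hG hZ hR h₁ φ₁ hφ₁
  obtain ⟨π₂, hπ₂⟩ := exists_abelian_retraction hp hG hZ hR h₂ φ₂ hφ₂
  exact stronglyEmbeddable_of_retractions h₁ h₂ φ₁ φ₂ hφ₁ hφ₂ π₁ hπ₁ π₂ hπ₂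

end Amalgam

/-! ### Overgroups with prescribed commutators and roots. -/

section Extensions

variable {G : Type u} [Group G] {p n : ℕ}

/-- A homomorphism `θ` to an abelian group of exponent `q` is realized by commutation with an
element of exponent `q` in an overgroup. -/
theorem exists_noncommuting_extension (hodd : Odd p) (hG : N₂B (p ^ n) G) {q : ℕ}
    (hq : q ∣ p ^ n) {T : Type u} [CommGroup T] (hT : ∀ t : T, t ^ q = 1) (θ : G →* T) :
    ∃ (K : Type u) (_ : Group K) (φ : G →* K) (y : K), N₂B (p ^ n) K ∧ Function.Injective φ ∧
      y ^ q = 1 ∧ ∀ g, Commute y (φ g) → θ g = 1 := by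
  -- With y the identity endomorphism of T, the commutator of g and y is θ g, placed in the last
  -- factor.
  let β : Twist (G × (T →* T) × T) :=
    { toFun := fun X Y => (1, 1, Y.2.1 (θ X.1))
      mul_left := fun X Y Z => by simp
      mul_right := fun X Y Z => by simp
      central := fun X Y Z => by ext1 <;> simp [mul_comm]
      self_left := fun X Y Z => by simp
      self_right := fun X Y Z => by simp }
  have hβ : ∀ X Y, β.toFun X Y = (1, 1, Y.2.1 (θ X.1)) := fun _ _ => rfl
  have hTn : ∀ t : T, t ^ p ^ n = 1 := fun t => by
    obtain ⟨k, hk⟩ := hq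
    rw [hk, pow_mul, hT, one_pow]
  have hP : N₂ (G × (T →* T) × T) := hG.1.prod (N₂.of_comm.prod N₂.of_comm)
  have hPB : B (p ^ n) (G × (T →* T) × T) :=
    hG.2.prod (B.prod (fun f => MonoidHom.ext fun t => hTn (f t)) hTn)
  let φ : G →* Twisted β := MonoidHom.mk' (fun g => ⟨(g, 1, 1)⟩) fun g h => by
    ext1
    rw [Twisted.val_mul, hβ]
    simp
  refine ⟨Twisted β, inferInstance, φ, ⟨(1, MonoidHom.id T, 1)⟩,
    ⟨Twisted.N₂ β hP, Twisted.B β hodd hPB⟩, ?_, ?_, ?_⟩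
  · intro g h hgh
    exact congrArg (fun X : Twisted β => X.val.1) hgh
  · ext1
    rw [Twisted.val_pow, hβ]
    have : (MonoidHom.id T) ^ q = 1 := MonoidHom.ext fun t => hT t
    simp [this, Twisted.val_one]
  · intro g hg
    have h1 := congrArg (fun X : Twisted β => X.val.2.2) hg.eq
    simp only [Twisted.val_mul, hβ] at h1
    simpa [φ] using h1.symm

/-- In a suitable overgroup, every element of a given central subgroup becomes a commutator. -/
theorem exists_commutator_extension (hodd : Odd p) (hG : N₂B (p ^ n) G) {Z : Type u} [CommGroup Z]
    (hZ : ∀ z : Z, z ^ p ^ n = 1) (k : Z →* G) (hk : ∀ z w, k z * w = w * k z) :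
    ∃ (K : Type u) (_ : Group K) (φ : G →* K), N₂B (p ^ n) K ∧ Function.Injective φ ∧
      ∀ z, φ (k z) ∈ commutator K := by
  -- The evaluation pairing: commutation with the identity endomorphism sends each z to k z,
  -- handling all z at once.
  let β : Twist (G × (Z →* Z) × Z) :=
    { toFun := fun X Y => (k (X.2.1 Y.2.2), 1, 1)
      mul_left := fun X Y Z => by simp
      mul_right := fun X Y Z => by simp
      central := fun X Y W => by
        ext1
        · simp [hk]
        · exact mul_comm _ _
      self_left := fun X Y Z => by simp
      self_right := fun X Y Z => by simp }
  have hβ : ∀ X Y, β.toFun X Y = (k (X.2.1 Y.2.2), 1, 1) := fun _ _ => rfl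
  have hP : N₂ (G × (Z →* Z) × Z) := hG.1.prod (N₂.of_comm.prod N₂.of_comm)
  have hPB : B (p ^ n) (G × (Z →* Z) × Z) :=
    hG.2.prod (B.prod (fun f => MonoidHom.ext fun t => hZ (f t)) hZ)
  let φ : G →* Twisted β := MonoidHom.mk' (fun g => ⟨(g, 1, 1)⟩) fun g h => by
    ext1
    rw [Twisted.val_mul, hβ]
    simp
  refine ⟨Twisted β, inferInstance, φ, ⟨Twisted.N₂ β hP, Twisted.B β hodd hPB⟩, ?_, ?_⟩
  · intro g h hgh
    exact congrArg (fun X : Twisted β => X.val.1) hgh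
  · intro z
    have : φ (k z) = ⁅(⟨(1, MonoidHom.id Z, 1)⟩ : Twisted β), ⟨(1, 1, z)⟩⁆ := by
      ext1
      rw [Twisted.val_commutator, hβ, hβ]
      ext1
      · simp [φ, commutatorElement_def]
      · simp [φ, commutatorElement_def]
    rw [this]
    exact Subgroup.commutator_mem_commutator (Subgroup.mem_top _) (Subgroup.mem_top _)

/-- A central element may stop being central in an overgroup, but a commutator stays central in
every class-two overgroup. -/
theorem exists_center_le_commutator_extension (hodd : Odd p) (hG : N₂B (p ^ n) G) :
    ∃ (K : Type u) (_ : Group K) (φ : G →* K), N₂B (p ^ n) K ∧ Function.Injective φ ∧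
      ∀ z ∈ Subgroup.center G, φ z ∈ commutator K := by
  let _ : CommGroup (Subgroup.center G) :=
    { (inferInstance : Group (Subgroup.center G)) with
      mul_comm := fun a b => Subtype.ext (Subgroup.mem_center_iff.1 b.2 a) }
  obtain ⟨K, _, φ, hK, hφ, h⟩ := exists_commutator_extension hodd hG (Z := Subgroup.center G)
    (fun z => Subtype.ext (hG.2 z)) (Subgroup.subtype _)
    (fun z w => (Subgroup.mem_center_iff.1 z.2 w).symm)
  exact ⟨K, _, φ, hK, hφ, fun z hz => h ⟨z, hz⟩⟩

/-- The twist `((h, b, t, s), (h', b', t', s')) ↦ (1, 1, [h'] ^ s, 1)`, which lets the last factor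
act on `G` by central automorphisms. -/
def rootTwist (G Y : Type u) [Group G] [CommGroup Y] :
    Twist (G × Y × Abelianization G × Multiplicative ℤ) where
  toFun X X' := (1, 1, Abelianization.of X'.1 ^ X.2.2.2.toAdd, 1)
  mul_left X X' X'' := by simp [zpow_add]
  mul_right X X' X'' := by simp [mul_zpow]
  central X X' X'' := by
    ext1
    · simp
    · exact mul_comm _ _
  self_left X X' X'' := by simp
  self_right X X' X'' := by simp

theorem rootTwist_apply {Y : Type u} [CommGroup Y]
    (X X' : G × Y × Abelianization G × Multiplicative ℤ) :
    (rootTwist G Y).toFun X X' = (1, 1, Abelianization.of X'.1 ^ X.2.2.2.toAdd, 1) := rfl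

theorem of_central (hZ : Subgroup.center G = commutator G) {z : G} (hz : ∀ w, z * w = w * z) :
    Abelianization.of z = 1 := by
  rw [← MonoidHom.mem_ker, Abelianization.ker_of, ← hZ, Subgroup.mem_center_iff]
  exact fun w => (hz w).symm

/-- The relations identifying `g` with the product of a central element and the `q`-th power of
the new element. -/
def rootRel (hG : N₂ G) (hZ : Subgroup.center G = commutator G) {Y : Type u} [CommGroup Y]
    (j : Y →* G) (g : G) (q : ℕ) : Subgroup (Twisted (rootTwist G Y)) where
  -- Imposing g = a r^q with a central forces [y,g] = [y,r]^q, so [y,g] is paired with [y]^q in the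
  -- third coordinate; r must commute with g, which accounts for [g]^c. The factor z identifies
  -- central elements of G in the range of j with their copies in Y, as needed to bound the order of
  -- r.
  carrier := {X | ∃ (z : G) (m c : ℤ) (y : G), (∀ w, z * w = w * z) ∧ X.val.1 = z * g ^ m ∧
    j X.val.2.1 = (z * g ^ m)⁻¹ * ⁅y, g⁆ ∧
    X.val.2.2.1 = Abelianization.of y ^ q * Abelianization.of g ^ c ∧
    X.val.2.2.2 = Multiplicative.ofAdd (-(q * m) : ℤ)}
  one_mem' := ⟨1, 0, 0, 1, by simp [Twisted.val_one]⟩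
  mul_mem' := by
    rintro X X' ⟨z, m, c, y, hz, h1, h2, h3, h4⟩ ⟨z', m', c', y', hz', h1', h2', h3', h4'⟩
    have e : z * z' * g ^ (m + m') = (z' * g ^ m') * (z * g ^ m) := by
      rw [add_comm, zpow_add, hz z', mul_assoc, mul_assoc, ← mul_assoc z (g ^ m'), hz (g ^ m')]
      simp only [mul_assoc]
    have e' : z * z' * g ^ (m + m') = (z * g ^ m) * (z' * g ^ m') := by
      rw [zpow_add, mul_assoc, mul_assoc, ← mul_assoc z' (g ^ m), hz' (g ^ m)]
      simp only [mul_assoc]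
    -- The twist of the exponent -qm against g^m' produces [g]^(-qmm'), absorbed into c.
    refine ⟨z * z', m + m', c + c' - q * m * m', y * y', fun w => ?_, ?_, ?_, ?_, ?_⟩
    · rw [mul_assoc, hz', ← mul_assoc, hz, mul_assoc]
    · rw [Twisted.val_mul, rootTwist_apply]
      simp only [Prod.fst_mul, mul_one]
      rw [h1, h1', e']
    · rw [Twisted.val_mul, rootTwist_apply]
      simp only [Prod.fst_mul, Prod.snd_mul, mul_one]
      rw [map_mul, h2, h2', e, mul_inv_rev, hG.mul_left, mul_assoc, mul_assoc,
        ← mul_assoc ⁅y, g⁆, hG.comm y g]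
      simp only [mul_assoc, mul_inv_rev]
    · rw [Twisted.val_mul, rootTwist_apply]
      simp only [Prod.fst_mul, Prod.snd_mul]
      rw [h3, h3', h1', h4, map_mul, map_mul, of_central hZ hz', one_mul, map_zpow, toAdd_ofAdd,
        ← zpow_mul, mul_pow, sub_eq_add_neg, zpow_add, zpow_add,
        show m' * -((q : ℤ) * m) = -(q * m * m') by ring]
      simp only [mul_assoc, mul_left_comm]
    · rw [Twisted.val_mul, rootTwist_apply]
      simp only [Prod.snd_mul, mul_one]
      rw [h4, h4', ← ofAdd_add]
      congr 1
      ring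
  inv_mem' := by
    rintro X ⟨z, m, c, y, hz, h1, h2, h3, h4⟩
    have hz' : ∀ w, z⁻¹ * w = w * z⁻¹ := fun w => (Commute.inv_left (hz w)).eq
    refine ⟨z⁻¹, -m, -c - q * m * m, y⁻¹, hz', ?_, ?_, ?_, ?_⟩
    · rw [Twisted.val_inv, rootTwist_apply]
      simp only [Prod.fst_mul, Prod.fst_inv, mul_one]
      rw [h1, mul_inv_rev, hz', zpow_neg]
    · rw [Twisted.val_inv, rootTwist_apply]
      simp only [Prod.fst_mul, Prod.snd_mul, Prod.fst_inv, Prod.snd_inv, mul_one]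
      rw [map_inv, h2, mul_inv_rev, inv_inv, hG.inv_left, ← commutatorElement_inv, inv_inv,
        ← hG.comm, hz', mul_inv_rev, inv_inv, zpow_neg, inv_inv, hz]
    · rw [Twisted.val_inv, rootTwist_apply]
      simp only [Prod.fst_mul, Prod.snd_mul, Prod.fst_inv, Prod.snd_inv]
      rw [h3, h1, h4, map_mul, of_central hZ hz, one_mul, map_zpow, toAdd_ofAdd, ← zpow_mul,
        map_inv, mul_inv, sub_eq_add_neg, zpow_add, zpow_neg, inv_pow,
        show m * -((q : ℤ) * m) = -(q * m * m) by ring]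
      simp only [mul_assoc]
    · rw [Twisted.val_inv, rootTwist_apply]
      simp only [Prod.snd_mul, Prod.snd_inv, mul_one]
      rw [h4, ← ofAdd_neg]
      congr 1
      ring

theorem rootRel_normal (hG : N₂ G) (hZ : Subgroup.center G = commutator G) {Y : Type u}
    [CommGroup Y] (j : Y →* G) (g : G) (q : ℕ) : (rootRel hG hZ j g q).Normal := by
  constructor
  rintro X hX W
  have : ⁅W, X⁆ ∈ rootRel hG hZ j g q := by
    obtain ⟨z, m, c, y, hz, h1, h2, h3, h4⟩ := hX
    refine ⟨⁅W.val.1, g⁆ ^ m, 0, m * W.val.2.2.2.toAdd, W.val.1 ^ m, fun w => ?_, ?_, ?_, ?_, ?_⟩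
    · rw [← hG.zpow_left, hG.comm]
    · rw [Twisted.val_commutator, rootTwist_apply, rootTwist_apply]
      simp only [Prod.fst_mul, Prod.fst_inv, inv_one, mul_one, zpow_zero]
      change ⁅W.val.1, X.val.1⁆ = _
      rw [h1, hG.mul_right, commutatorElement_eq_one_iff_mul_comm.2 (hz W.val.1).symm, one_mul,
        hG.zpow_right]
    · rw [Twisted.val_commutator, rootTwist_apply, rootTwist_apply]
      simp only [Prod.fst_mul, Prod.snd_mul, Prod.fst_inv, Prod.snd_inv, inv_one, mul_one,
        zpow_zero]
      change j ⁅W.val.2.1, X.val.2.1⁆ = _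
      rw [commutatorElement_eq_one_iff_mul_comm.2 (mul_comm _ _), map_one, hG.zpow_left,
        inv_mul_cancel]
    · rw [Twisted.val_commutator, rootTwist_apply, rootTwist_apply]
      simp only [Prod.fst_mul, Prod.snd_mul, Prod.fst_inv, Prod.snd_inv]
      change ⁅W.val.2.2.1, X.val.2.2.1⁆ * _ = _
      rw [commutatorElement_eq_one_iff_mul_comm.2 (mul_comm _ _), one_mul, h1, h4, map_mul,
        of_central hZ hz, one_mul, map_zpow, map_zpow, toAdd_ofAdd, ← zpow_mul, ← zpow_neg,
        ← zpow_natCast, ← zpow_mul, mul_comm]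
      congr 2
      ring
    · rw [Twisted.val_commutator, rootTwist_apply, rootTwist_apply]
      simp only [Prod.snd_mul, Prod.snd_inv, inv_one, mul_one]
      change ⁅W.val.2.2.2, X.val.2.2.2⁆ = _
      rw [commutatorElement_eq_one_iff_mul_comm.2 (mul_comm _ _)]
      simp
  have h3 := mul_mem this hX
  rwa [commutatorElement_def, inv_mul_cancel_right] at h3

/-- If no element of `G` obstructs it, then `g` has a `p ^ i`-th root modulo the center in an
overgroup. -/
theorem exists_root_extension_of_hom (hodd : Odd p) (hG : N₂B (p ^ n) G)
    (hZ : Subgroup.center G = commutator G) {i : ℕ} (hi : i ≤ n) (g : G)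
    (hobs : ∀ (c : ℤ) (y : G),
      Abelianization.of (y ^ p ^ i) = Abelianization.of (g ^ c) → ⁅y, g⁆ = 1)
    {Y : Type u} [CommGroup Y] (hY : ∀ y : Y, y ^ p ^ n = 1) (j : Y →* G) (g₀ : Y) (hg₀ : j g₀ = g) :
    ∃ (K : Type u) (_ : Group K) (φ : G →* K) (r a : K), N₂B (p ^ n) K ∧ Function.Injective φ ∧
      a ∈ Subgroup.center K ∧ φ g = a * r ^ p ^ i := by
  have hP : N₂ (G × Y × Abelianization G × Multiplicative ℤ) :=
    hG.1.prod ((N₂.of_comm (L := Y)).prod ((N₂.of_comm (L := Abelianization G)).prod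
      (N₂.of_comm (L := Multiplicative ℤ))))
  let N := rootRel hG.1 hZ j g (p ^ i)
  have hN : N.Normal := rootRel_normal hG.1 hZ j g (p ^ i)
  let π := QuotientGroup.mk' N
  let φ : G →* Twisted (rootTwist G Y) := MonoidHom.mk' (fun g => ⟨(g, 1, 1, 1)⟩) fun g h => by
    ext1
    rw [Twisted.val_mul, rootTwist_apply]
    simp
  let r : Twisted (rootTwist G Y) := ⟨(1, 1, 1, Multiplicative.ofAdd 1)⟩
  let a : Twisted (rootTwist G Y) := ⟨(1, g₀, 1, 1)⟩
  -- [g^(p^(n-i)), w] is inverse to [w^(p^(n-i)), g], and w^(p^(n-i)) has trivial p^i-th power, so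
  -- `hobs` applies.
  have hcentral : ∀ w : G, g ^ p ^ (n - i) * w = w * g ^ p ^ (n - i) := by
    intro w
    rw [← commutatorElement_eq_one_iff_mul_comm, hG.1.pow_left, ← commutatorElement_inv, inv_pow,
      ← hG.1.pow_left, inv_eq_one]
    refine hobs (p ^ n : ℕ) _ ?_
    rw [← pow_mul, ← pow_add, Nat.sub_add_cancel hi, zpow_natCast, hG.2, hG.2]
  refine ⟨Twisted (rootTwist G Y) ⧸ N, inferInstance, π.comp φ, π r, π a,
    ⟨(Twisted.N₂ _ hP).of_surjective π (QuotientGroup.mk'_surjective N), ?_⟩, ?_, ?_, ?_⟩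
  · intro w
    obtain ⟨X, rfl⟩ := QuotientGroup.mk'_surjective N w
    rw [← map_pow]
    refine (QuotientGroup.eq_one_iff _).2 ?_
    obtain ⟨k, hk⟩ := dvd_choose_two (n := n) hodd
    have hA : ∀ t : Abelianization G, t ^ p ^ n = 1 := fun t => by
      obtain ⟨t, rfl⟩ := ab_surjective t
      rw [← map_pow, hG.2, map_one]
    have e1 : (X ^ p ^ n).val.1 = 1 := by
      rw [Twisted.val_pow, rootTwist_apply]
      simp only [Prod.fst_mul, Prod.pow_fst, hG.2 _, one_pow, mul_one]
    have e2 : (X ^ p ^ n).val.2.1 = 1 := by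
      rw [Twisted.val_pow, rootTwist_apply]
      simp only [Prod.fst_mul, Prod.snd_mul, Prod.pow_fst, Prod.pow_snd, hY, one_pow, mul_one]
    have e3 : (X ^ p ^ n).val.2.2.1 = 1 := by
      rw [Twisted.val_pow, rootTwist_apply]
      simp only [Prod.fst_mul, Prod.snd_mul, Prod.pow_fst, Prod.pow_snd, hA, hk, pow_mul, one_pow,
        mul_one]
    have e4 : (X ^ p ^ n).val.2.2.2 = X.val.2.2.2 ^ p ^ n := by
      rw [Twisted.val_pow, rootTwist_apply]
      simp only [Prod.snd_mul, Prod.pow_snd, one_pow, mul_one]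
    have e5 : (g ^ p ^ (n - i)) ^ X.val.2.2.2.toAdd *
        g ^ (-((p ^ (n - i) : ℕ) * X.val.2.2.2.toAdd : ℤ)) = 1 := by
      rw [← zpow_natCast, ← zpow_mul, ← zpow_add, add_neg_cancel, zpow_zero]
    -- The central power of g and g^m cancel in the G coordinate, while m accounts for the integer
    -- coordinate, a multiple of p^n.
    refine ⟨_, _, 0, 1, fun w => ?_, e1.trans e5.symm, ?_, ?_, ?_⟩
    · exact ((show Commute (g ^ p ^ (n - i)) w from hcentral w).zpow_left _).eq
    · rw [e2, e5, map_one, commutatorElement_one_left, inv_one, mul_one]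
    · rw [e3, map_one, one_pow, zpow_zero, mul_one]
    · rw [e4, ← ofAdd_toAdd (X.val.2.2.2), ← ofAdd_nsmul, toAdd_ofAdd, mul_neg, neg_neg,
        ← mul_assoc, ← Nat.cast_mul, ← pow_add, Nat.add_sub_cancel' hi, nsmul_eq_mul]
  -- For h in G, the integer coordinate gives m = 0, the third gives y^(p^i) ≡ g^(-c), `hobs` then
  -- kills [y,g], and the second coordinate gives h = 1.
  · rw [injective_iff_map_eq_one]
    intro h hh
    obtain ⟨z, m, c, y, hz, h1, h2, h3, h4⟩ := (QuotientGroup.eq_one_iff _).1 hh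
    have h4' : (0 : ℤ) = -((p ^ i : ℕ) * m) := congrArg Multiplicative.toAdd h4
    have hm : m = 0 := by
      rcases mul_eq_zero.1 (neg_eq_zero.1 h4'.symm) with h | h
      · exact absurd (Nat.cast_eq_zero.1 h) (pow_pos hodd.pos i).ne'
      · exact h
    have h3' : 1 = Abelianization.of y ^ p ^ i * Abelianization.of g ^ c := h3
    have hy : ⁅y, g⁆ = 1 := hobs (-c) y (by
      rw [map_pow, map_zpow, zpow_neg]
      exact eq_inv_of_mul_eq_one_left h3'.symm)
    have h2' : j 1 = (z * g ^ m)⁻¹ * ⁅y, g⁆ := h2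
    have h1' : h = z * g ^ m := h1
    rw [map_one, hy, mul_one, ← h1'] at h2'
    exact inv_eq_one.1 h2'.symm
  · rw [Subgroup.mem_center_iff]
    intro w
    obtain ⟨X, rfl⟩ := QuotientGroup.mk'_surjective N w
    rw [← map_mul, ← map_mul]
    congr 1
    ext1
    rw [Twisted.val_mul, Twisted.val_mul, rootTwist_apply, rootTwist_apply]
    change X.val * (1, g₀, 1, 1) * _ = (1, g₀, 1, 1) * X.val * _
    ext
    · simp
    · simp [mul_comm]
    · simp [a]
    · simp
  · rw [← map_pow, ← map_mul]
    have e : (a * r ^ p ^ i).val = (1, g₀, 1, Multiplicative.ofAdd ((p ^ i : ℕ) : ℤ)) := by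
      rw [Twisted.val_mul, Twisted.val_pow, rootTwist_apply, rootTwist_apply]
      ext <;> simp [a, r, ← ofAdd_nsmul]
    have : (a * r ^ p ^ i)⁻¹ * φ g ∈ N := by
      refine ⟨1, 1, -(p ^ i : ℕ), 1, fun w => by rw [one_mul, mul_one], ?_, ?_, ?_, ?_⟩
      · rw [Twisted.val_mul, Twisted.val_inv, e, rootTwist_apply, rootTwist_apply]
        simp [φ]
      · rw [Twisted.val_mul, Twisted.val_inv, e, rootTwist_apply, rootTwist_apply]
        simp [φ, hg₀]
      · rw [Twisted.val_mul, Twisted.val_inv, e, rootTwist_apply, rootTwist_apply]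
        simp [φ]
      · rw [Twisted.val_mul, Twisted.val_inv, e, rootTwist_apply, rootTwist_apply]
        simp [φ]
    exact (QuotientGroup.eq.2 this).symm

theorem exists_root_extension (hodd : Odd p) (hG : N₂B (p ^ n) G)
    (hZ : Subgroup.center G = commutator G) {i : ℕ} (hi : i ≤ n) (g : G)
    (hobs : ∀ (c : ℤ) (y : G),
      Abelianization.of (y ^ p ^ i) = Abelianization.of (g ^ c) → ⁅y, g⁆ = 1) :
    ∃ (K : Type u) (_ : Group K) (φ : G →* K) (r a : K), N₂B (p ^ n) K ∧ Function.Injective φ ∧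
      a ∈ Subgroup.center K ∧ φ g = a * r ^ p ^ i := by
  let _ : CommGroup (Subgroup.zpowers g) :=
    { (inferInstance : Group (Subgroup.zpowers g)) with
      mul_comm := fun a b => Subtype.ext (by
        obtain ⟨_, k, rfl⟩ := a
        obtain ⟨_, l, rfl⟩ := b
        exact zpow_mul_comm g k l) }
  exact exists_root_extension_of_hom hodd hG hZ hi g hobs (Y := Subgroup.zpowers g)
    (fun y => Subtype.ext (hG.2 y)) (Subgroup.subtype _) ⟨g, Subgroup.mem_zpowers g⟩ rfl

end Extensions

/-! ### Weak bases satisfy the root condition. -/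

section Bases

variable {G : Type u} [Group G] {p n : ℕ}

/-- Both factors have exponent p^n, so they land in the p^n-torsion subgroup of the amalgam, which
can replace it. -/
theorem IsWeakAmalgamationBase.restrict (hodd : Odd p) (hG : N₂B (p ^ n) G)
    (h : IsWeakAmalgamationBase N₂ G) : IsWeakAmalgamationBase (N₂B (p ^ n)) G := by
  refine ⟨hG, ?_⟩
  intro K₁ K₂ _ _ φ₁ φ₂ h₁ h₂ hφ₁ hφ₂
  obtain ⟨M, _, l₁, l₂, hM, hl₁, hl₂, hl⟩ := h.2 K₁ K₂ φ₁ φ₂ h₁.1 h₂.1 hφ₁ hφ₂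
  have m₁ : ∀ x, l₁ x ∈ hM.torsion hodd n := fun x => by
    change l₁ x ^ p ^ n = 1
    rw [← map_pow, h₁.2, map_one]
  have m₂ : ∀ x, l₂ x ∈ hM.torsion hodd n := fun x => by
    change l₂ x ^ p ^ n = 1
    rw [← map_pow, h₂.2, map_one]
  refine ⟨hM.torsion hodd n, inferInstance, l₁.codRestrict _ m₁, l₂.codRestrict _ m₂,
    hM.torsion_class hodd n, fun x y hxy => hl₁ (congrArg Subtype.val hxy),
    fun x y hxy => hl₂ (congrArg Subtype.val hxy), ?_⟩
  ext g
  exact DFunLike.congr_fun hl g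

theorem IsStrongAmalgamationBase.restrict (hodd : Odd p) (hG : N₂B (p ^ n) G)
    (h : IsStrongAmalgamationBase N₂ G) : IsStrongAmalgamationBase (N₂B (p ^ n)) G := by
  refine ⟨hG, ?_⟩
  intro K₁ K₂ _ _ φ₁ φ₂ h₁ h₂ hφ₁ hφ₂
  obtain ⟨M, _, l₁, l₂, hM, hl₁, hl₂, hl, hst⟩ := h.2 K₁ K₂ φ₁ φ₂ h₁.1 h₂.1 hφ₁ hφ₂
  have m₁ : ∀ x, l₁ x ∈ hM.torsion hodd n := fun x => by
    change l₁ x ^ p ^ n = 1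
    rw [← map_pow, h₁.2, map_one]
  have m₂ : ∀ x, l₂ x ∈ hM.torsion hodd n := fun x => by
    change l₂ x ^ p ^ n = 1
    rw [← map_pow, h₂.2, map_one]
  refine ⟨hM.torsion hodd n, inferInstance, l₁.codRestrict _ m₁, l₂.codRestrict _ m₂,
    hM.torsion_class hodd n, fun x y hxy => hl₁ (congrArg Subtype.val hxy),
    fun x y hxy => hl₂ (congrArg Subtype.val hxy), ?_,
    fun a b hab => hst a b (congrArg Subtype.val hab)⟩
  ext g
  exact DFunLike.congr_fun hl g

theorem IsStrongAmalgamationBase.weak {C : GroupClass.{u}} (h : IsStrongAmalgamationBase C G) :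
    IsWeakAmalgamationBase C G := by
  refine ⟨h.1, ?_⟩
  intro K₁ K₂ _ _ φ₁ φ₂ h₁ h₂ hφ₁ hφ₂
  obtain ⟨M, _, l₁, l₂, hM, hl₁, hl₂, hl, -⟩ := h.2 K₁ K₂ φ₁ φ₂ h₁ h₂ hφ₁ hφ₂
  exact ⟨M, _, l₁, l₂, hM, hl₁, hl₂, hl⟩

/-- An element that is not a `q`-th power modulo the commutator subgroup fails to commute with
some element of exponent `q` of an overgroup. -/
theorem exists_noncommuting_of_not_pow (hodd : Odd p) (hG : N₂B (p ^ n) G) {q : ℕ}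
    (hq : q ∣ p ^ n) {g : G} (hg : ¬ ∃ a : Abelianization G, Abelianization.of g = a ^ q) :
    ∃ (K : Type u) (_ : Group K) (φ : G →* K) (y : K), N₂B (p ^ n) K ∧ Function.Injective φ ∧
      y ^ q = 1 ∧ ¬ Commute y (φ g) := by
  let R : Subgroup (Abelianization G) := (powMonoidHom q).range
  obtain ⟨K, _, φ, y, hK, hφ, hy, hyc⟩ := exists_noncommuting_extension hodd hG hq
    (T := Abelianization G ⧸ R) (fun t => by
      obtain ⟨t, rfl⟩ := QuotientGroup.mk'_surjective R t
      rw [← map_pow]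
      exact (QuotientGroup.eq_one_iff _).2 ⟨t, rfl⟩)
    ((QuotientGroup.mk' R).comp Abelianization.of)
  refine ⟨K, _, φ, y, hK, hφ, hy, fun hc => hg ?_⟩
  obtain ⟨a, ha⟩ := (QuotientGroup.eq_one_iff _).1 (hyc g hc)
  exact ⟨a, ha.symm⟩

/-- A central g outside G' fails to commute with something in one overgroup and is a commutator in
another. -/
theorem center_eq_of_weakBase (hodd : Odd p) (hG : N₂B (p ^ n) G)
    (h : IsWeakAmalgamationBase (N₂B (p ^ n)) G) : Subgroup.center G = commutator G := by
  refine le_antisymm (fun g hg => ?_) hG.1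
  by_contra hgc
  obtain ⟨K₁, _, φ₁, y, hK₁, hφ₁, -, hy⟩ :=
    exists_noncommuting_of_not_pow hodd hG dvd_rfl (g := g) (by
      rintro ⟨a, ha⟩
      obtain ⟨a, rfl⟩ := ab_surjective a
      rw [← map_pow, hG.2, map_one, ← MonoidHom.mem_ker, Abelianization.ker_of] at ha
      exact hgc ha)
  obtain ⟨K₂, _, φ₂, hK₂, hφ₂, hc⟩ := exists_center_le_commutator_extension hodd hG
  obtain ⟨M, _, l₁, l₂, hM, hl₁, hl₂, hl⟩ := h.2 K₁ K₂ φ₁ φ₂ hK₁ hK₂ hφ₁ hφ₂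
  apply hy
  apply hl₁
  rw [map_mul, map_mul, show l₁ (φ₁ g) = l₂ (φ₂ g) from DFunLike.congr_fun hl g]
  exact (hM.1.of_ker_central (map_of_eq_one l₂ (hc g hg)) _).symm

theorem rootObstructed_of_weakBase (hodd : Odd p) (hG : N₂B (p ^ n) G)
    (h : IsWeakAmalgamationBase (N₂B (p ^ n)) G) : RootObstructed p n G := by
  intro i _ hin g
  have hi : i ≤ n := hin.trans (Nat.sub_le n 1)
  by_contra hcon
  obtain ⟨hg, hobs⟩ := not_or.1 hcon
  rw [mem_powSubgroup_sup] at hg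
  have hZ := center_eq_of_weakBase hodd hG h
  obtain ⟨K₁, _, φ₁, y, hK₁, hφ₁, hyq, hy⟩ :=
    exists_noncommuting_of_not_pow hodd hG (pow_dvd_pow p hi) hg
  obtain ⟨K, _, φ, r, a, hK, hφ, ha, hgr⟩ := exists_root_extension hodd hG hZ hi g (by
    intro c y hcy
    rw [commutatorElement_eq_one_iff_mul_comm]
    by_contra hne
    have hpos : (0 : ℤ) < (p ^ n : ℕ) := Int.natCast_pos.2 (pow_pos hodd.pos n)
    obtain ⟨d, hd⟩ : ∃ d : ℕ, (d : ℤ) = c % (p ^ n : ℕ) :=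
      ⟨_, Int.toNat_of_nonneg (Int.emod_nonneg c hpos.ne')⟩
    -- Reducing c modulo p^n and adding p^n makes the exponent positive without changing the power
    -- of g.
    refine hobs ⟨d + p ^ n, y, Nat.add_pos_right _ (pow_pos hodd.pos n), ?_, fun hc =>
      hne (commute_of_inv_mul.1 hc).eq⟩
    have hgd : g ^ c = g ^ d := by
      rw [← Int.emod_add_mul_ediv c (p ^ n : ℕ), zpow_add, zpow_mul, zpow_natCast g (p ^ n),
        hG.2, one_zpow, mul_one, ← hd, zpow_natCast]
    rw [hcy, hgd, pow_add, hG.2, mul_one])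
  obtain ⟨K₂, _, ψ, hK₂, hψ, hc⟩ := exists_center_le_commutator_extension hodd hK
  obtain ⟨M, _, l₁, l₂, hM, hl₁, hl₂, hl⟩ :=
    h.2 K₁ K₂ φ₁ (ψ.comp φ) hK₁ hK₂ hφ₁ (hψ.comp hφ)
  apply hy
  apply hl₁
  rw [map_mul, map_mul, show l₁ (φ₁ g) = l₂ (ψ (φ g)) from DFunLike.congr_fun hl g, hgr,
    map_mul, map_mul, map_pow, map_pow]
  -- In M, [y, a r^q] = [y,a][y^q,r], where a is central as a commutator and y^q = 1.
  refine commutatorElement_eq_one_iff_mul_comm.1 ?_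
  rw [hM.1.mul_right, hM.1.pow_right, ← hM.1.pow_left, ← map_pow, hyq, map_one,
    commutatorElement_one_left, mul_one, commutatorElement_eq_one_iff_mul_comm]
  exact (hM.1.of_ker_central (map_of_eq_one l₂ (hc a ha)) _).symm

end Bases

end NilTwo

theorem mainTheorem3 (p n : ℕ) (hp : p.Prime) (hodd : Odd p) (hn : 0 < n)
    (G : Type u) [Group G] (hG : NilTwo.N₂B (p ^ n) G) :
    List.TFAE
      [NilTwo.IsWeakAmalgamationBase NilTwo.N₂ G,
       NilTwo.IsWeakAmalgamationBase (NilTwo.N₂B (p ^ n)) G,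
       Subgroup.center G = commutator G ∧
         ∀ i : ℕ, 1 ≤ i → i ≤ n - 1 → ∀ g : G,
           g ∈ NilTwo.powSubgroup (p ^ i) G ⊔ commutator G ∨
             ∃ (c : ℕ) (y : G), 0 < c ∧
               Abelianization.of (y ^ p ^ i) = Abelianization.of (g ^ c) ∧ y⁻¹ * g⁻¹ * y * g ≠ 1,
       NilTwo.IsStrongAmalgamationBase (NilTwo.N₂B (p ^ n)) G,
       NilTwo.IsStrongAmalgamationBase NilTwo.N₂ G] := by
  tfae_have 1 → 2 := fun h => h.restrict hodd hG
  tfae_have 2 → 3 := fun h =>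
    ⟨NilTwo.center_eq_of_weakBase hodd hG h, NilTwo.rootObstructed_of_weakBase hodd hG h⟩
  tfae_have 3 → 5 := fun h =>
    NilTwo.isStrongAmalgamationBase_of_rootObstructed hp hG h.1 h.2
  tfae_have 5 → 4 := fun h => h.restrict hodd hG
  tfae_have 4 → 2 := fun h => h.weak
  tfae_have 5 → 1 := fun h => h.weak
  tfae_finish
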